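/- Let $H$ be a (real or complex) Hilbert space, let $E$ be a Banach space, and let $0<\alpha\le 1$ and $L\ge 0$ be real numbers. A map $f\colon A\to B$ between metric spaces is called an $(\alpha,L)$-Hölder map if $d_B(f(x),f(x'))\le L\,d_A(x,x')^{\alpha}$ for all $x,x'\in A$. Let $X\subset H$ be a finite subset, let $S\subset X$ be a nonempty subset, and let $f\colon S\to E$ be an $(\alpha,L)$-Hölder map. Then there is a map $\overline f\colon X\to \operatorname{Conv}(\operatorname{Im} f)$ with $\overline f|_S=f$, where $\operatorname{Conv}(\operatorname{Im} f)$ is the convex hull of the image of $f$ in $E$, such that $\overline f$ is an $(\alpha,\overline L)$-Hölder map for some real number $\overline L\ge 0$ with $$\overline L\le \left(\sqrt{m+1}\right)^{\alpha} L,\qquad m:=|X\setminus S|.$$ -/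

import Mathlib

open scoped NNReal

/-! The extension is an average of `f ∘ r` over random retractions `r : X → S`, so its values lie in
the convex hull. It suffices that the mean of `‖r x - r y‖ ^ 2` is at most `(m + 1) * ‖x - y‖ ^ 2`
for every pair; Jensen's inequality then passes from the square to the power `α`.

By separation (`exists_mem_stdSimplex_forall_sum_nonpos`) it is enough to bound weighted sums over
all pairs, with the distribution allowed to depend on the weights `w`. For symmetric positive `w`,
draw a forest rooted at `S` with probability proportional to the product of its edge weights, and
send each point to its root. Two facts give the bound. Exchanging an extra edge with a forest edge
shifts depth from one end to the other, so the cost of all edges is at most `m + 1` times that of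
edges leaving `S` (`sum_forestWeight_mul_le`). The mean root is harmonic off `S`, so the latter cost
is the Dirichlet energy of the harmonic extension of the inclusion of `S`, which is at most the
energy of the inclusion of `X` (`sum_boundary_le_energy`). -/

section RootedForest

/-! ### Rooted forests as parent maps. -/

variable {V : Type*}

/-- A parent map on `V` all of whose orbits end in the set `S` of roots. -/
def IsRootedForest (S : Finset V) (φ : V → V) : Prop :=
  (∀ s ∈ S, φ s = s) ∧ ∀ x, ∃ k, φ^[k] x ∈ S

/-- The number of steps from `x` to the set of roots. -/
noncomputable def forestDepth (S : Finset V) (φ : V → V) (x : V) : ℕ :=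
  sInf {k | φ^[k] x ∈ S}

/-- The root reached from `x`. -/
noncomputable def forestRoot (S : Finset V) (φ : V → V) (x : V) : V :=
  φ^[forestDepth S φ x] x

namespace IsRootedForest

variable {S : Finset V} {φ : V → V}

lemma root_mem (h : IsRootedForest S φ) (x : V) : forestRoot S φ x ∈ S :=
  Nat.sInf_mem (h.2 x)

lemma depth_le {k : ℕ} {x : V} (hk : φ^[k] x ∈ S) : forestDepth S φ x ≤ k :=
  Nat.sInf_le hk

lemma iterate_root (h : IsRootedForest S φ) {s : V} (hs : s ∈ S) (k : ℕ) : φ^[k] s = s :=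
  Function.iterate_fixed (h.1 s hs) k

lemma root_eq_of_mem (h : IsRootedForest S φ) {k : ℕ} {x : V} (hk : φ^[k] x ∈ S) :
    forestRoot S φ x = φ^[k] x := by
  obtain ⟨j, rfl⟩ := Nat.exists_eq_add_of_le (depth_le hk)
  rw [add_comm, Function.iterate_add_apply]
  exact (h.iterate_root (h.root_mem x) j).symm

lemma root_of_mem (h : IsRootedForest S φ) {s : V} (hs : s ∈ S) : forestRoot S φ s = s :=
  h.root_eq_of_mem (k := 0) hs

lemma depth_eq_zero_iff (h : IsRootedForest S φ) {x : V} : forestDepth S φ x = 0 ↔ x ∈ S := by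
  refine ⟨fun hx => ?_, fun hx => Nat.le_zero.1 (depth_le (k := 0) hx)⟩
  have := h.root_mem x
  rwa [forestRoot, hx] at this

lemma root_apply (h : IsRootedForest S φ) (x : V) :
    forestRoot S φ (φ x) = forestRoot S φ x := by
  have hm : φ^[forestDepth S φ (φ x) + 1] x ∈ S := h.root_mem (φ x)
  exact (h.root_eq_of_mem hm).symm

lemma root_iterate (h : IsRootedForest S φ) (k : ℕ) (x : V) :
    forestRoot S φ (φ^[k] x) = forestRoot S φ x := by
  induction k with
  | zero => rfl
  | succ k ih => rw [Function.iterate_succ_apply', h.root_apply, ih]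

lemma depth_apply (h : IsRootedForest S φ) {x : V} (hx : x ∉ S) :
    forestDepth S φ x = forestDepth S φ (φ x) + 1 := by
  apply le_antisymm
  · exact depth_le (k := forestDepth S φ (φ x) + 1) (h.root_mem (φ x))
  · have h0 : forestDepth S φ x ≠ 0 := fun h0 => hx (h.depth_eq_zero_iff.1 h0)
    obtain ⟨d, hd⟩ := Nat.exists_eq_succ_of_ne_zero h0
    have hm := h.root_mem x
    rw [forestRoot, hd] at hm
    rw [hd]
    exact Nat.succ_le_succ (depth_le hm)

lemma depth_le_card [Fintype V] [DecidableEq V] (h : IsRootedForest S φ) (x : V) :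
    forestDepth S φ x ≤ Sᶜ.card := by
  have key := Finset.card_le_card_of_injOn (s := Finset.range (forestDepth S φ x)) (t := Sᶜ)
    (fun i => φ^[i] x) ?_ ?_
  · simpa using key
  · intro i hi
    simp only [Finset.coe_range, Set.mem_Iio] at hi
    simp only [Finset.coe_compl, Set.mem_compl_iff, Finset.mem_coe]
    exact fun hm => absurd (depth_le hm) (not_le.2 hi)
  · have aux : ∀ i j, i < j → j < forestDepth S φ x → φ^[i] x ≠ φ^[j] x := by
      intro i j hij hj heq
      -- A repetition in the orbit gives a shortcut of length `j - i` to the roots, against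
      -- minimality of the depth.
      have hm : φ^[forestDepth S φ x - j + i] x ∈ S := by
        rw [Function.iterate_add_apply, heq, ← Function.iterate_add_apply,
          Nat.sub_add_cancel hj.le]
        exact h.root_mem x
      have := depth_le hm
      omega
    intro i hi j hj heq
    simp only [Finset.coe_range, Set.mem_Iio] at hi hj
    rcases lt_trichotomy i j with hij | hij | hij
    · exact absurd heq (aux i j hij hj)
    · exact hij
    · exact absurd heq.symm (aux j i hij hi)

/-- The orbit of the parent of a non-root vertex does not return to that vertex. -/
lemma iterate_apply_ne (h : IsRootedForest S φ) {x : V} (hx : x ∉ S) (k : ℕ) :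
    φ^[k] (φ x) ≠ x := by
  intro hk
  have h1 := h.depth_apply hx
  have h2 : forestDepth S φ (φ^[k] (φ x)) ≤ forestDepth S φ (φ x) := by
    apply depth_le
    rw [← Function.iterate_add_apply, add_comm, Function.iterate_add_apply]
    have := h.root_mem (φ x)
    rw [forestRoot] at this
    rwa [h.iterate_root this]
  rw [hk] at h2
  omega

lemma iterate_ne_of_root_ne (h : IsRootedForest S φ) {x y : V}
    (hr : forestRoot S φ x ≠ forestRoot S φ y) (k : ℕ) : φ^[k] y ≠ x := by
  rintro rfl
  exact hr (h.root_iterate k y)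

end IsRootedForest

/-! ### Changing the parent of one vertex. -/

section Update

variable [DecidableEq V] {S : Finset V} {φ : V → V} {x y : V}

lemma iterate_update_of_ne {z : V} (hz : ∀ k, φ^[k] z ≠ x) (k : ℕ) :
    (Function.update φ x y)^[k] z = φ^[k] z := by
  induction k with
  | zero => rfl
  | succ k ih =>
    rw [Function.iterate_succ_apply', ih, Function.update_of_ne (hz k),
      Function.iterate_succ_apply']

lemma forestDepth_update_of_ne {z : V} (hz : ∀ k, φ^[k] z ≠ x) :
    forestDepth S (Function.update φ x y) z = forestDepth S φ z := by
  simp only [forestDepth, iterate_update_of_ne hz]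

lemma forestRoot_update_of_ne {z : V} (hz : ∀ k, φ^[k] z ≠ x) :
    forestRoot S (Function.update φ x y) z = forestRoot S φ z := by
  simp only [forestRoot, forestDepth_update_of_ne hz, iterate_update_of_ne hz]

/-- Moving a non-root vertex together with its descendants to another place in the forest. -/
lemma IsRootedForest.update (h : IsRootedForest S φ) (hx : x ∉ S) (hy : ∀ k, φ^[k] y ≠ x) :
    IsRootedForest S (Function.update φ x y) := by
  have hxr : ∃ k, (Function.update φ x y)^[k] x ∈ S := by
    refine ⟨forestDepth S φ y + 1, ?_⟩
    rw [Function.iterate_succ_apply, Function.update_self, iterate_update_of_ne hy]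
    exact h.root_mem y
  refine ⟨fun s hs => ?_, fun z => ?_⟩
  · rw [Function.update_of_ne (by rintro rfl; exact hx hs), h.1 s hs]
  · obtain ⟨n, hn⟩ := h.2 z
    induction n generalizing z with
    | zero => exact ⟨0, hn⟩
    | succ n ih =>
      by_cases hzx : z = x
      · exact hzx ▸ hxr
      · obtain ⟨k, hk⟩ := ih (φ z) hn
        refine ⟨k + 1, ?_⟩
        rwa [Function.iterate_succ_apply, Function.update_of_ne hzx]

end Update

/-! ### Forest weights and harmonicity of the root distribution. -/

/-- The weight of a forest: the product of the weights of its edges. -/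
def forestWeight [Fintype V] [DecidableEq V] (S : Finset V) (w : V → V → ℝ) (φ : V → V) : ℝ :=
  ∏ x ∈ Sᶜ, w x (φ x)

/-- Only the factor at `x` changes. The product form avoids dividing by `w x (φ x)`, which may
vanish. -/
lemma forestWeight_update [Fintype V] [DecidableEq V] {S : Finset V} (w : V → V → ℝ)
    (φ : V → V) {x : V} (y : V) (hx : x ∉ S) :
    forestWeight S w (Function.update φ x y) * w x (φ x) = forestWeight S w φ * w x y := by
  have hx' : x ∈ Sᶜ := by simpa using hx
  unfold forestWeight
  rw [← Finset.mul_prod_erase _ _ hx', ← Finset.mul_prod_erase _ (fun z => w z (φ z)) hx',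
    Function.update_self]
  have : ∏ z ∈ Sᶜ.erase x, w z (Function.update φ x y z) = ∏ z ∈ Sᶜ.erase x, w z (φ z) :=
    Finset.prod_congr rfl fun z hz => by rw [Function.update_of_ne (Finset.ne_of_mem_erase hz)]
  rw [this]
  ring

open Classical in
/-- The set of forests on `V` with root set `S`. -/
noncomputable def rootedForests [Fintype V] (S : Finset V) : Finset (V → V) :=
  Finset.univ.filter (IsRootedForest S)

lemma mem_rootedForests [Fintype V] {S : Finset V} {φ : V → V} :
    φ ∈ rootedForests S ↔ IsRootedForest S φ := by
  simp [rootedForests]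

lemma rootedForests_nonempty [Fintype V] {S : Finset V} (hS : S.Nonempty) :
    (rootedForests S).Nonempty := by
  classical
  obtain ⟨s, hs⟩ := hS
  refine ⟨fun x => if x ∈ S then x else s, mem_rootedForests.2 ⟨fun t ht => if_pos ht,
    fun x => ⟨1, ?_⟩⟩⟩
  by_cases hx : x ∈ S <;> simp [hx, hs]

/-- The expectation of a function of the root is harmonic off the set of roots. -/
lemma sum_forestWeight_smul_root_sub [Fintype V] [DecidableEq V] {M : Type*} [AddCommGroup M]
    [Module ℝ M] (S : Finset V) (w : V → V → ℝ) (g : V → M) {x : V} (hx : x ∉ S) :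
    ∑ q ∈ rootedForests S ×ˢ (Finset.univ : Finset V), (forestWeight S w q.1 * w x q.2) •
      (g (forestRoot S q.1 x) - g (forestRoot S q.1 q.2)) = 0 := by
  classical
  -- If `y` is not a descendant of `x`, swapping the parent `φ x` with `y` preserves the weight and
  -- exchanges the two roots, so terms cancel in pairs. If `y` descends from `x`, the roots agree
  -- and the term is zero.
  rw [← Finset.sum_filter_add_sum_filter_not _
    (fun q : (V → V) × V => ∀ k, q.1^[k] q.2 ≠ x), Finset.sum_involution
      (fun q _ => (Function.update q.1 x q.2, q.1 x)), Finset.sum_eq_zero, add_zero]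
  · rintro ⟨φ, y⟩ hq
    simp only [Finset.mem_filter, Finset.mem_product, mem_rootedForests, not_forall,
      not_not] at hq
    obtain ⟨⟨h, -⟩, k, rfl⟩ := hq
    simp [h.root_iterate]
  · rintro ⟨φ, y⟩ hq
    simp only [Finset.mem_filter, Finset.mem_product, mem_rootedForests] at hq
    obtain ⟨⟨h, -⟩, hy⟩ := hq
    have h' := h.update hx hy
    have e1 : forestRoot S (Function.update φ x y) x = forestRoot S φ y := by
      rw [← h'.root_apply, Function.update_self, forestRoot_update_of_ne hy]
    have e2 : forestRoot S (Function.update φ x y) (φ x) = forestRoot S φ x := by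
      rw [forestRoot_update_of_ne (h.iterate_apply_ne hx), h.root_apply]
    simp only [forestWeight_update w φ y hx, e1, e2]
    rw [← smul_add]
    simp
  · rintro ⟨φ, y⟩ hq hne heq
    simp only [Finset.mem_filter, Finset.mem_product, mem_rootedForests] at hq
    apply hne
    simp only [Prod.mk.injEq] at heq
    simp [← heq.2, hq.1.1.root_apply]
  · rintro ⟨φ, y⟩ hq
    simp only [Finset.mem_filter, Finset.mem_product, mem_rootedForests] at hq ⊢
    obtain ⟨⟨h, -⟩, hy⟩ := hq
    refine ⟨⟨h.update hx hy, Finset.mem_univ _⟩, fun k => ?_⟩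
    rw [iterate_update_of_ne (h.iterate_apply_ne hx)]
    exact h.iterate_apply_ne hx k
  · rintro ⟨φ, y⟩ hq
    simp

/-! ### Exchanging the extra edge with a forest edge. -/

/-- The total weight of the forests with an additional edge joining a vertex of depth `k` to a
vertex of depth `l`, weighted by a function `G` of the two roots. -/
noncomputable def forestEdgeSum [Fintype V] [DecidableEq V] (S : Finset V) (w G : V → V → ℝ)
    (k l : ℕ) : ℝ :=
  ∑ q ∈ (rootedForests S ×ˢ ((Finset.univ : Finset V) ×ˢ (Finset.univ : Finset V))).filter
      (fun q => forestDepth S q.1 q.2.1 = k ∧ forestDepth S q.1 q.2.2 = l ∧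
        forestRoot S q.1 q.2.1 ≠ forestRoot S q.1 q.2.2),
    forestWeight S w q.1 * w q.2.1 q.2.2 * G (forestRoot S q.1 q.2.1) (forestRoot S q.1 q.2.2)

lemma forestEdgeSum_nonneg [Fintype V] [DecidableEq V] (S : Finset V) {w G : V → V → ℝ}
    (hw : ∀ x y, 0 ≤ w x y) (hG : ∀ x y, 0 ≤ G x y) (k l : ℕ) :
    0 ≤ forestEdgeSum S w G k l :=
  Finset.sum_nonneg fun _ _ => mul_nonneg (mul_nonneg
    (Finset.prod_nonneg fun _ _ => hw _ _) (hw _ _)) (hG _ _)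

/-- Hang `x` below `y` and release its old edge: the extra edge `(x, y)` becomes `(φ x, x)`, of
depths `k` and `l + 1`, with the same pair of roots. Distinct roots ensure that no cycle arises;
symmetry of `w` preserves the weight. -/
lemma forestEdgeSum_succ_left [Fintype V] [DecidableEq V] (S : Finset V) {w : V → V → ℝ}
    (hw : ∀ x y, w x y = w y x) (G : V → V → ℝ) (k l : ℕ) :
    forestEdgeSum S w G (k + 1) l = forestEdgeSum S w G k (l + 1) := by
  unfold forestEdgeSum
  refine Finset.sum_nbij' (fun q => (Function.update q.1 q.2.1 q.2.2, q.1 q.2.1, q.2.1))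
    (fun q => (Function.update q.1 q.2.2 q.2.1, q.2.2, q.1 q.2.2)) ?_ ?_ ?_ ?_ ?_
  · rintro ⟨φ, x, y⟩ hq
    simp only [Finset.mem_filter, Finset.mem_product, mem_rootedForests, Finset.mem_univ,
      and_true] at hq ⊢
    obtain ⟨h, hk, hl, hr⟩ := hq
    have hx : x ∉ S := fun hx => by simp [h.depth_eq_zero_iff.2 hx] at hk
    have hy := h.iterate_ne_of_root_ne hr
    have h' := h.update hx hy
    have hd := h.depth_apply hx
    refine ⟨h', ?_, ?_, ?_⟩
    · rw [forestDepth_update_of_ne (h.iterate_apply_ne hx)]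
      omega
    · rw [h'.depth_apply hx, Function.update_self, forestDepth_update_of_ne hy, hl]
    · rw [← h'.root_apply x, Function.update_self, forestRoot_update_of_ne hy,
        forestRoot_update_of_ne (h.iterate_apply_ne hx), h.root_apply]
      exact hr
  · rintro ⟨φ, x, y⟩ hq
    simp only [Finset.mem_filter, Finset.mem_product, mem_rootedForests, Finset.mem_univ,
      and_true] at hq ⊢
    obtain ⟨h, hk, hl, hr⟩ := hq
    have hy : y ∉ S := fun hy => by simp [h.depth_eq_zero_iff.2 hy] at hl
    have hx := h.iterate_ne_of_root_ne hr.symm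
    have h' := h.update hy hx
    have hd := h.depth_apply hy
    refine ⟨h', ?_, ?_, ?_⟩
    · rw [h'.depth_apply hy, Function.update_self, forestDepth_update_of_ne hx, hk]
    · rw [forestDepth_update_of_ne (h.iterate_apply_ne hy)]
      omega
    · rw [← h'.root_apply y, Function.update_self, forestRoot_update_of_ne hx,
        forestRoot_update_of_ne (h.iterate_apply_ne hy), h.root_apply]
      exact hr
  · rintro ⟨φ, x, y⟩ -
    simp
  · rintro ⟨φ, x, y⟩ -
    simp
  · rintro ⟨φ, x, y⟩ hq
    simp only [Finset.mem_filter, Finset.mem_product, mem_rootedForests, Finset.mem_univ,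
      and_true] at hq ⊢
    obtain ⟨h, hk, hl, hr⟩ := hq
    have hx : x ∉ S := fun hx => by simp [h.depth_eq_zero_iff.2 hx] at hk
    have hy := h.iterate_ne_of_root_ne hr
    have h' := h.update hx hy
    rw [hw (φ x) x, forestWeight_update w φ y hx, ← h'.root_apply x, Function.update_self,
      forestRoot_update_of_ne hy, forestRoot_update_of_ne (h.iterate_apply_ne hx), h.root_apply]

lemma forestEdgeSum_eq_left_zero [Fintype V] [DecidableEq V] (S : Finset V) {w : V → V → ℝ}
    (hw : ∀ x y, w x y = w y x) (G : V → V → ℝ) (k l : ℕ) :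
    forestEdgeSum S w G k l = forestEdgeSum S w G 0 (k + l) := by
  induction k generalizing l with
  | zero => rw [zero_add]
  | succ k ih => rw [forestEdgeSum_succ_left S hw, ih, add_right_comm, add_assoc]

lemma forestEdgeSum_eq_zero_of_lt [Fintype V] [DecidableEq V] (S : Finset V) (w G : V → V → ℝ)
    {k l : ℕ} (hl : Sᶜ.card < l) : forestEdgeSum S w G k l = 0 := by
  unfold forestEdgeSum
  rw [Finset.filter_eq_empty_iff.2, Finset.sum_empty]
  rintro ⟨φ, x, y⟩ hq ⟨-, h2, -⟩
  simp only [Finset.mem_product, mem_rootedForests] at hq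
  exact (hq.1.depth_le_card y).not_gt (h2 ▸ hl)

lemma sum_forestEdgeSum_le [Fintype V] [DecidableEq V] (S : Finset V) {w G : V → V → ℝ}
    (hw : ∀ x y, w x y = w y x) (hw0 : ∀ x y, 0 ≤ w x y) (hG : ∀ x y, 0 ≤ G x y) :
    ∑ k ∈ Finset.range (Sᶜ.card + 1), ∑ l ∈ Finset.range (Sᶜ.card + 1),
      forestEdgeSum S w G k l ≤
    (Sᶜ.card + 1) * ∑ l ∈ Finset.range (Sᶜ.card + 1), forestEdgeSum S w G 0 l := by
  have key : ∀ k ∈ Finset.range (Sᶜ.card + 1),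
      ∑ l ∈ Finset.range (Sᶜ.card + 1), forestEdgeSum S w G k l ≤
      ∑ l ∈ Finset.range (Sᶜ.card + 1), forestEdgeSum S w G 0 l := by
    intro k _
    calc ∑ l ∈ Finset.range (Sᶜ.card + 1), forestEdgeSum S w G k l
        = ∑ l ∈ Finset.range (Sᶜ.card + 1), forestEdgeSum S w G 0 (k + l) :=
          Finset.sum_congr rfl fun l _ => forestEdgeSum_eq_left_zero S hw G k l
      -- The window of total depths starting at `k` is extended down to `0`; its part above
      -- `Sᶜ.card` contributes nothing.
      _ ≤ ∑ l ∈ Finset.range (k + (Sᶜ.card + 1)), forestEdgeSum S w G 0 l := by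
          rw [Finset.sum_range_add _ k]
          exact le_add_of_nonneg_left
            (Finset.sum_nonneg fun l _ => forestEdgeSum_nonneg S hw0 hG 0 l)
      _ = ∑ l ∈ Finset.range (Sᶜ.card + 1), forestEdgeSum S w G 0 l := by
          rw [add_comm k, Finset.sum_range_add _ _ k, add_eq_left]
          exact Finset.sum_eq_zero fun l _ => forestEdgeSum_eq_zero_of_lt S w G (by omega)
  calc _ ≤ _ := Finset.sum_le_sum key
    _ = _ := by simp

lemma sum_range_forestEdgeSum [Fintype V] [DecidableEq V] (S : Finset V) (w : V → V → ℝ)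
    {G : V → V → ℝ} (hG : ∀ x, G x x = 0) (k : ℕ) :
    ∑ l ∈ Finset.range (Sᶜ.card + 1), forestEdgeSum S w G k l =
      ∑ q ∈ (rootedForests S ×ˢ ((Finset.univ : Finset V) ×ˢ (Finset.univ : Finset V))).filter
        (fun q => forestDepth S q.1 q.2.1 = k), forestWeight S w q.1 * w q.2.1 q.2.2 *
          G (forestRoot S q.1 q.2.1) (forestRoot S q.1 q.2.2) := by
  rw [← Finset.sum_fiberwise_of_maps_to (t := Finset.range (Sᶜ.card + 1))
    (g := fun q : (V → V) × V × V => forestDepth S q.1 q.2.2)]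
  · refine Finset.sum_congr rfl fun l _ => ?_
    unfold forestEdgeSum
    rw [Finset.filter_filter]
    refine Finset.sum_subset (fun q => ?_) fun q hq hq' => ?_
    · simp only [Finset.mem_filter]
      tauto
    · simp only [Finset.mem_filter, not_and, not_not] at hq hq'
      rw [hq' hq.1 hq.2.1 hq.2.2, hG, mul_zero]
  · rintro ⟨φ, x, y⟩ hq
    simp only [Finset.mem_filter, Finset.mem_product, mem_rootedForests] at hq
    exact Finset.mem_range.2 (Nat.lt_succ_of_le (hq.1.1.depth_le_card y))

/-- The expected cost of the images of all edges under the root map is at most `|Sᶜ| + 1` times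
that of the edges with an end in `S`. -/
lemma sum_forestWeight_mul_le [Fintype V] [DecidableEq V] (S : Finset V) {w G : V → V → ℝ}
    (hw : ∀ x y, w x y = w y x) (hw0 : ∀ x y, 0 ≤ w x y) (hG0 : ∀ x y, 0 ≤ G x y)
    (hG : ∀ x, G x x = 0) :
    ∑ φ ∈ rootedForests S, ∑ x, ∑ y, forestWeight S w φ * w x y *
      G (forestRoot S φ x) (forestRoot S φ y) ≤
    (Sᶜ.card + 1) * ∑ φ ∈ rootedForests S, ∑ s ∈ S, ∑ y, forestWeight S w φ * w s y *
      G s (forestRoot S φ y) := by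
  have h1 := sum_forestEdgeSum_le S hw hw0 hG0
  simp only [sum_range_forestEdgeSum S w hG] at h1
  rw [Finset.sum_fiberwise_of_maps_to] at h1
  · convert h1 using 1
    · simp only [Finset.sum_product]
    · congr 1
      rw [Finset.sum_filter, Finset.sum_product]
      refine Finset.sum_congr rfl fun φ hφ => ?_
      rw [mem_rootedForests] at hφ
      rw [Finset.sum_product, ← Finset.sum_subset (Finset.subset_univ S)]
      · refine Finset.sum_congr rfl fun s hs => Finset.sum_congr rfl fun y _ => ?_
        rw [if_pos (hφ.depth_eq_zero_iff.2 hs), hφ.root_of_mem hs]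
      · intro x _ hx
        refine Finset.sum_eq_zero fun y _ => if_neg ?_
        exact fun h0 => hx (hφ.depth_eq_zero_iff.1 h0)
  · rintro ⟨φ, x, y⟩ hq
    simp only [Finset.mem_product, mem_rootedForests] at hq
    exact Finset.mem_range.2 (Nat.lt_succ_of_le (hq.1.depth_le_card x))

end RootedForest

/-! ### Minimax by separation. -/

/-- If every positive combination of finitely many linear costs can be made nonpositive by some
probability vector, then a single probability vector makes all the costs nonpositive. -/
lemma exists_mem_stdSimplex_forall_sum_nonpos {R P : Type*} [Fintype R] [Nonempty R] [Fintype P]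
    (A : R → P → ℝ)
    (h : ∀ w : P → ℝ, (∀ p, 0 < w p) →
      ∃ μ ∈ stdSimplex ℝ R, ∑ p, w p * ∑ r, μ r * A r p ≤ 0) :
    ∃ μ ∈ stdSimplex ℝ R, ∀ p, ∑ r, μ r * A r p ≤ 0 := by
  classical
  by_contra! hcon
  let C : (R → ℝ) →ₗ[ℝ] (P → ℝ) := (Matrix.of A).vecMulLinear
  have hC : ∀ μ p, C μ p = ∑ r, μ r * A r p := fun μ p => by
    simp [C, Matrix.vecMul, dotProduct]
  have hCc : Continuous C := LinearMap.continuous_of_finiteDimensional C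
  have hK : IsCompact (C '' stdSimplex ℝ R) := (isCompact_stdSimplex ℝ R).image hCc
  have hKc : Convex ℝ (C '' stdSimplex ℝ R) := (convex_stdSimplex ℝ R).linear_image C
  have hdisj : Disjoint (C '' stdSimplex ℝ R) (Set.Iic (0 : P → ℝ)) := by
    rw [Set.disjoint_left]
    rintro _ ⟨μ, hμ, rfl⟩ hle
    obtain ⟨p, hp⟩ := hcon μ hμ
    have := hle p
    rw [hC] at this
    exact absurd this (not_le.2 hp)
  obtain ⟨F, u, v, hFu, huv, hFv⟩ := geometric_hahn_banach_compact_closed hKc hK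
    (convex_Iic (𝕜 := ℝ) (0 : P → ℝ)) isClosed_Iic hdisj
  have hv : v < 0 := by simpa using hFv 0 (Set.mem_Iic.2 le_rfl)
  have hF : ∀ z : P → ℝ, F z = ∑ p, z p * F (Pi.single p 1) := by
    intro z
    conv_lhs => rw [pi_eq_sum_univ' z]
    simp [map_sum]
  have hF0 : ∀ p, F (Pi.single p 1) ≤ 0 := by
    intro p
    by_contra! hp
    have hmem : (v / F (Pi.single p 1)) • (Pi.single p 1 : P → ℝ) ∈ Set.Iic (0 : P → ℝ) := by
      rw [Set.mem_Iic]
      exact smul_nonpos_of_nonpos_of_nonneg (div_nonpos_of_nonpos_of_nonneg hv.le hp.le)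
        (by simp)
    have := hFv _ hmem
    rw [map_smul, smul_eq_mul, div_mul_cancel₀ _ hp.ne'] at this
    exact lt_irrefl _ this
  obtain ⟨B, hB⟩ : ∃ B, ∀ z ∈ C '' stdSimplex ℝ R, ‖∑ p, z p‖ ≤ B :=
    hK.exists_bound_of_continuousOn (by fun_prop)
  -- The weights `-F (Pi.single p 1)` are only nonnegative. Adding this constant makes them
  -- positive, yet changes the total cost too little to bridge the gap `-u`.
  have hε : 0 < -u / (|B| + 1) := div_pos (by linarith) (by positivity)
  obtain ⟨μ, hμ, hle⟩ := h (fun p => -F (Pi.single p 1) + -u / (|B| + 1))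
    (fun p => by linarith [hF0 p])
  have h1 := hFu _ ⟨μ, hμ, rfl⟩
  have h2 := hB _ ⟨μ, hμ, rfl⟩
  have h3 : ∑ p, (-F (Pi.single p 1) + -u / (|B| + 1)) * ∑ r, μ r * A r p =
      -F (C μ) + -u / (|B| + 1) * ∑ p, C μ p := by
    rw [hF (C μ), Finset.mul_sum, ← Finset.sum_neg_distrib, ← Finset.sum_add_distrib]
    refine Finset.sum_congr rfl fun p _ => ?_
    rw [hC]
    ring
  rw [h3] at hle
  have h4 : -u / (|B| + 1) * -(∑ p, C μ p) ≤ -u / (|B| + 1) * (|B| + 1) := by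
    refine mul_le_mul_of_nonneg_left ?_ hε.le
    have := (abs_le.1 h2).1
    linarith [le_abs_self B]
  rw [div_mul_cancel₀ _ (by positivity)] at h4
  linarith

/-! ### Dirichlet energy on a weighted graph. -/

section Energy

variable {V : Type*} [Fintype V]

lemma sum_sum_mul_sub_eq_zero {w : V → V → ℝ} (hw : ∀ x y, w x y = w y x) (k : V → ℝ) :
    ∑ x, ∑ y, w x y * (k x - k y) = 0 := by
  have h : ∑ x, ∑ y, w x y * (k x - k y) = ∑ x, ∑ y, -(w x y * (k x - k y)) := by
    rw [Finset.sum_comm]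
    exact Finset.sum_congr rfl fun x _ => Finset.sum_congr rfl fun y _ => by rw [hw]; ring
  simp only [Finset.sum_neg_distrib] at h
  linarith

variable {H : Type*} [NormedAddCommGroup H] [InnerProductSpace ℝ H]

/-- Summation by parts on a weighted graph. -/
lemma sum_sum_mul_inner_sub_sub {w : V → V → ℝ} (hw : ∀ x y, w x y = w y x) (p h : V → H) :
    ∑ x, ∑ y, w x y * inner ℝ (p x - p y) (h x - h y) =
      2 * ∑ x, inner ℝ (p x) (∑ y, w x y • (h x - h y)) := by
  have h1 : ∑ x, inner ℝ (p x) (∑ y, w x y • (h x - h y)) =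
      ∑ x, ∑ y, w x y * inner ℝ (p x) (h x - h y) := by
    simp only [inner_sum, inner_smul_right]
  have h2 : ∑ x, ∑ y, w x y * inner ℝ (p x) (h x - h y) =
      ∑ x, ∑ y, -(w x y * inner ℝ (p y) (h x - h y)) := by
    rw [Finset.sum_comm]
    refine Finset.sum_congr rfl fun x _ => Finset.sum_congr rfl fun y _ => ?_
    rw [hw, ← neg_sub (h x), inner_neg_right]
    ring
  rw [h1, two_mul]
  nth_rewrite 2 [h2]
  simp only [← Finset.sum_add_distrib]
  refine Finset.sum_congr rfl fun x _ => Finset.sum_congr rfl fun y _ => ?_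
  rw [inner_sub_left]
  ring

/-- The harmonic extension minimises the energy, expressed through boundary values. Here `k` is
the harmonic extension of the squared norms of the boundary values. -/
lemma sum_boundary_le_energy {w : V → V → ℝ} (hw : ∀ x y, w x y = w y x)
    (hw0 : ∀ x y, 0 ≤ w x y) {S : Finset V} {p h : V → H} {k : V → ℝ}
    (hp : ∀ s ∈ S, h s = p s) (hk : ∀ s ∈ S, k s = ‖p s‖ ^ 2)
    (hh : ∀ x ∉ S, ∑ y, w x y • (h x - h y) = 0)
    (hkh : ∀ x ∉ S, ∑ y, w x y * (k x - k y) = 0) :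
    ∑ s ∈ S, ∑ y, w s y * (‖p s‖ ^ 2 - 2 * inner ℝ (p s) (h y) + k y) ≤
      ∑ x, ∑ y, w x y * ‖p x - p y‖ ^ 2 := by
  -- The total flux of `k` vanishes by antisymmetry, and off `S` there is none.
  have hflux : ∑ s ∈ S, ∑ y, w s y * (k s - k y) = 0 := by
    rw [Finset.sum_subset (Finset.subset_univ S) fun x _ hx => hkh x hx]
    exact sum_sum_mul_sub_eq_zero hw k
  have hres : ∀ q : V → H, (∀ s ∈ S, q s = p s) →
      ∑ x, ∑ y, w x y * inner ℝ (q x - q y) (h x - h y) =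
        2 * ∑ s ∈ S, inner ℝ (p s) (∑ y, w s y • (h s - h y)) := by
    intro q hq
    rw [sum_sum_mul_inner_sub_sub hw, ← Finset.sum_subset (Finset.subset_univ S)
      fun x _ hx => by rw [hh x hx, inner_zero_right]]
    rw [Finset.sum_congr rfl fun s hs => by rw [hq s hs]]
  have hlhs : ∑ s ∈ S, ∑ y, w s y * (‖p s‖ ^ 2 - 2 * inner ℝ (p s) (h y) + k y) =
      2 * ∑ s ∈ S, inner ℝ (p s) (∑ y, w s y • (h s - h y)) := by
    rw [← sub_eq_zero, ← neg_eq_zero, ← hflux, Finset.mul_sum, ← Finset.sum_sub_distrib,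
      ← Finset.sum_neg_distrib]
    refine Finset.sum_congr rfl fun s hs => ?_
    rw [inner_sum, Finset.mul_sum, ← Finset.sum_sub_distrib, ← Finset.sum_neg_distrib]
    refine Finset.sum_congr rfl fun y _ => ?_
    rw [hk s hs, hp s hs, inner_smul_right, inner_sub_right, real_inner_self_eq_norm_sq]
    ring
  have e1 := hres p fun _ _ => rfl
  have e2 := hres h hp
  -- Both sums on the left equal the boundary term, by `e1` and `e2`, so expanding the nonnegative
  -- energy of `p - h` suffices.
  have e3 : 2 * ∑ x, ∑ y, w x y * inner ℝ (p x - p y) (h x - h y) -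
      ∑ x, ∑ y, w x y * inner ℝ (h x - h y) (h x - h y) ≤
      ∑ x, ∑ y, w x y * ‖p x - p y‖ ^ 2 := by
    rw [Finset.mul_sum, ← Finset.sum_sub_distrib]
    refine Finset.sum_le_sum fun x _ => ?_
    rw [Finset.mul_sum, ← Finset.sum_sub_distrib]
    refine Finset.sum_le_sum fun y _ => ?_
    have h0 := mul_nonneg (hw0 x y) (sq_nonneg ‖(p x - p y) - (h x - h y)‖)
    rw [norm_sub_sq_real] at h0
    rw [real_inner_self_eq_norm_sq]
    linarith
  rw [hlhs]
  linarith

end Energy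

/-! ### The random retraction onto `S`. -/

section RandomRetraction

variable {V : Type*} [Fintype V] [DecidableEq V]

lemma sum_smul_expected_root_sub {M : Type*} [AddCommGroup M] [Module ℝ M] (S : Finset V)
    (w : V → V → ℝ) (c : ℝ) (g : V → M) {x : V} (hx : x ∉ S) :
    ∑ y, w x y • (∑ φ ∈ rootedForests S, (c * forestWeight S w φ) • g (forestRoot S φ x) -
      ∑ φ ∈ rootedForests S, (c * forestWeight S w φ) • g (forestRoot S φ y)) = 0 := by
  rw [← smul_zero c, ← sum_forestWeight_smul_root_sub S w g hx, Finset.sum_product_right,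
    Finset.smul_sum]
  refine Finset.sum_congr rfl fun y _ => ?_
  rw [← Finset.sum_sub_distrib, Finset.smul_sum, Finset.smul_sum]
  refine Finset.sum_congr rfl fun φ _ => ?_
  rw [← smul_sub, smul_smul, smul_smul]
  congr 1
  ring

variable {H : Type*} [NormedAddCommGroup H] [InnerProductSpace ℝ H]

lemma exists_forest_distribution_of_weight {S : Finset V} (hS : S.Nonempty) (p : V → H)
    {w : V → V → ℝ} (hw : ∀ x y, w x y = w y x) (hw0 : ∀ x y, 0 < w x y) :
    ∃ μ ∈ stdSimplex ℝ (rootedForests S), ∑ x, ∑ y, w x y *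
        ∑ φ, μ φ * ‖p (forestRoot S φ x) - p (forestRoot S φ y)‖ ^ 2 ≤
      (Sᶜ.card + 1) * ∑ x, ∑ y, w x y * ‖p x - p y‖ ^ 2 := by
  have hpos : ∀ φ, 0 < forestWeight S w φ := fun φ => Finset.prod_pos fun _ _ => hw0 _ _
  obtain ⟨Z, hZ⟩ : ∃ Z, Z = ∑ φ ∈ rootedForests S, forestWeight S w φ := ⟨_, rfl⟩
  have hZ0 : 0 < Z := hZ ▸ Finset.sum_pos (fun φ _ => hpos φ) (rootedForests_nonempty hS)
  have hμ1 : ∑ φ ∈ rootedForests S, Z⁻¹ * forestWeight S w φ = 1 := by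
    rw [← Finset.mul_sum, ← hZ, inv_mul_cancel₀ hZ0.ne']
  have hboundary : ∀ {M : Type _} [AddCommGroup M] [Module ℝ M] (g : V → M), ∀ s ∈ S,
      ∑ φ ∈ rootedForests S, (Z⁻¹ * forestWeight S w φ) • g (forestRoot S φ s) = g s := by
    intro M _ _ g s hs
    rw [Finset.sum_congr rfl fun φ hφ => by
      rw [(mem_rootedForests.1 hφ).root_of_mem hs], ← Finset.sum_smul, hμ1, one_smul]
  have henergy := sum_boundary_le_energy hw (fun x y => (hw0 x y).le) (S := S) (p := p)
    (h := fun x => ∑ φ ∈ rootedForests S, (Z⁻¹ * forestWeight S w φ) • p (forestRoot S φ x))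
    (k := fun x => ∑ φ ∈ rootedForests S,
      (Z⁻¹ * forestWeight S w φ) • ‖p (forestRoot S φ x)‖ ^ 2)
    (fun s hs => hboundary p s hs)
    (fun s hs => by
      rw [Finset.sum_congr rfl fun φ hφ => by
        rw [(mem_rootedForests.1 hφ).root_of_mem hs], ← Finset.sum_smul, hμ1, one_smul])
    (fun x hx => sum_smul_expected_root_sub S w Z⁻¹ p hx)
    (fun x hx => sum_smul_expected_root_sub S w Z⁻¹ (fun v => ‖p v‖ ^ 2) hx)
  refine ⟨fun φ => Z⁻¹ * forestWeight S w φ,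
    ⟨fun φ => mul_nonneg (inv_nonneg.2 hZ0.le) (hpos φ).le, ?_⟩, ?_⟩
  · rw [Finset.sum_coe_sort (rootedForests S) fun φ => Z⁻¹ * forestWeight S w φ, hμ1]
  have hforest := sum_forestWeight_mul_le S hw (fun x y => (hw0 x y).le)
    (G := fun x y => ‖p x - p y‖ ^ 2) (fun _ _ => sq_nonneg _) (fun x => by simp)
  have hexp : ∀ s y, ∑ φ ∈ rootedForests S,
      Z⁻¹ * forestWeight S w φ * ‖p s - p (forestRoot S φ y)‖ ^ 2 =
      ‖p s‖ ^ 2 - 2 * inner ℝ (p s)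
        (∑ φ ∈ rootedForests S, (Z⁻¹ * forestWeight S w φ) • p (forestRoot S φ y)) +
        ∑ φ ∈ rootedForests S, (Z⁻¹ * forestWeight S w φ) • ‖p (forestRoot S φ y)‖ ^ 2 := by
    intro s y
    rw [inner_sum, Finset.mul_sum]
    conv_rhs => rw [← one_mul (‖p s‖ ^ 2), ← hμ1, Finset.sum_mul]
    rw [← Finset.sum_sub_distrib, ← Finset.sum_add_distrib]
    refine Finset.sum_congr rfl fun φ _ => ?_
    rw [norm_sub_sq_real, inner_smul_right, smul_eq_mul]
    ring
  calc ∑ x, ∑ y, w x y * ∑ φ : rootedForests S, Z⁻¹ * forestWeight S w φ *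
        ‖p (forestRoot S φ x) - p (forestRoot S φ y)‖ ^ 2
      = Z⁻¹ * ∑ φ ∈ rootedForests S, ∑ x, ∑ y, forestWeight S w φ * w x y *
          ‖p (forestRoot S φ x) - p (forestRoot S φ y)‖ ^ 2 := by
        have hcoe : ∀ x y, ∑ φ : rootedForests S, Z⁻¹ * forestWeight S w φ *
            ‖p (forestRoot S φ x) - p (forestRoot S φ y)‖ ^ 2 =
            ∑ φ ∈ rootedForests S, Z⁻¹ * forestWeight S w φ *
              ‖p (forestRoot S φ x) - p (forestRoot S φ y)‖ ^ 2 := fun x y =>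
          Finset.sum_coe_sort (rootedForests S) fun φ => Z⁻¹ * forestWeight S w φ *
            ‖p (forestRoot S φ x) - p (forestRoot S φ y)‖ ^ 2
        simp only [hcoe, Finset.mul_sum]
        rw [Finset.sum_comm (s := rootedForests S)]
        refine Finset.sum_congr rfl fun x _ => ?_
        rw [Finset.sum_comm (s := rootedForests S)]
        refine Finset.sum_congr rfl fun y _ => Finset.sum_congr rfl fun φ _ => ?_
        ring
    _ ≤ Z⁻¹ * ((Sᶜ.card + 1) * ∑ φ ∈ rootedForests S, ∑ s ∈ S, ∑ y,
          forestWeight S w φ * w s y * ‖p s - p (forestRoot S φ y)‖ ^ 2) :=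
        mul_le_mul_of_nonneg_left hforest (inv_nonneg.2 hZ0.le)
    _ = (Sᶜ.card + 1) * ∑ s ∈ S, ∑ y, w s y * ∑ φ ∈ rootedForests S,
          Z⁻¹ * forestWeight S w φ * ‖p s - p (forestRoot S φ y)‖ ^ 2 := by
        rw [mul_left_comm]
        congr 1
        simp only [Finset.mul_sum]
        rw [Finset.sum_comm]
        refine Finset.sum_congr rfl fun s _ => ?_
        rw [Finset.sum_comm]
        refine Finset.sum_congr rfl fun y _ => Finset.sum_congr rfl fun φ _ => ?_
        ring
    _ ≤ (Sᶜ.card + 1) * ∑ x, ∑ y, w x y * ‖p x - p y‖ ^ 2 := by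
        simp only [hexp]
        exact mul_le_mul_of_nonneg_left henergy (by positivity)

/-- A finite set in a Hilbert space has a random retraction onto any nonempty subset `S` that
increases mean square distances by at most the factor `|Sᶜ| + 1`. -/
theorem exists_forest_distribution {S : Finset V} (hS : S.Nonempty) (p : V → H) :
    ∃ μ ∈ stdSimplex ℝ (rootedForests S), ∀ x y,
      ∑ φ, μ φ * ‖p (forestRoot S φ x) - p (forestRoot S φ y)‖ ^ 2 ≤
        (Sᶜ.card + 1) * ‖p x - p y‖ ^ 2 := by
  have : Nonempty (rootedForests S) := (rootedForests_nonempty hS).to_subtype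
  have hA : ∀ μ ∈ stdSimplex ℝ (rootedForests S), ∀ x y,
      ∑ φ, μ φ * (‖p (forestRoot S φ x) - p (forestRoot S φ y)‖ ^ 2 -
        (Sᶜ.card + 1) * ‖p x - p y‖ ^ 2) =
      ∑ φ, μ φ * ‖p (forestRoot S φ x) - p (forestRoot S φ y)‖ ^ 2 -
        (Sᶜ.card + 1) * ‖p x - p y‖ ^ 2 := by
    intro μ hμ x y
    simp only [mul_sub, Finset.sum_sub_distrib, ← Finset.sum_mul, hμ.2, one_mul]
  obtain ⟨μ, hμ, h⟩ : ∃ μ ∈ stdSimplex ℝ (rootedForests S), ∀ q : V × V,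
      ∑ φ, μ φ * (‖p (forestRoot S φ q.1) - p (forestRoot S φ q.2)‖ ^ 2 -
        (Sᶜ.card + 1) * ‖p q.1 - p q.2‖ ^ 2) ≤ 0 := by
    refine exists_mem_stdSimplex_forall_sum_nonpos
      (fun (φ : rootedForests S) (q : V × V) =>
        ‖p (forestRoot S φ q.1) - p (forestRoot S φ q.2)‖ ^ 2 -
          (Sᶜ.card + 1) * ‖p q.1 - p q.2‖ ^ 2) fun w hw => ?_
    -- The weights from separation need not be symmetric, but the costs are, so symmetrising doubles
    -- both sides.
    obtain ⟨μ, hμ, h⟩ := exists_forest_distribution_of_weight hS p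
      (w := fun x y => w (x, y) + w (y, x)) (fun x y => add_comm _ _)
      (fun x y => add_pos (hw _) (hw _))
    refine ⟨μ, hμ, ?_⟩
    simp only [hA μ hμ]
    have hsymm : ∀ T : V → V → ℝ, (∀ x y, T x y = T y x) →
        ∑ x, ∑ y, (w (x, y) + w (y, x)) * T x y = 2 * ∑ x, ∑ y, w (x, y) * T x y := by
      intro T hT
      simp only [add_mul, Finset.sum_add_distrib]
      rw [two_mul, add_right_inj, Finset.sum_comm]
      exact Finset.sum_congr rfl fun x _ => Finset.sum_congr rfl fun y _ => by rw [hT]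
    rw [hsymm _ fun x y => Finset.sum_congr rfl fun φ _ => by rw [norm_sub_rev],
      hsymm (fun x y => ‖p x - p y‖ ^ 2) fun x y => by rw [norm_sub_rev]] at h
    have hfactor : ∑ x, ∑ y, w (x, y) * ((Sᶜ.card + 1) * ‖p x - p y‖ ^ 2) =
        (Sᶜ.card + 1) * ∑ x, ∑ y, w (x, y) * ‖p x - p y‖ ^ 2 := by
      simp only [Finset.mul_sum, mul_left_comm]
    rw [Fintype.sum_prod_type]
    simp only [mul_sub, Finset.sum_sub_distrib]
    rw [hfactor]
    linarith
  refine ⟨μ, hμ, fun x y => ?_⟩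
  have := h (x, y)
  rw [hA μ hμ] at this
  exact sub_nonpos.1 this

/-- Jensen's inequality for `t ↦ t ^ (2 / α)`, convex because `2 / α ≥ 1`. -/
lemma sum_mul_rpow_le_of_sum_mul_sq_le {R : Type*} [Fintype R] {μ d : R → ℝ}
    (hμ : μ ∈ stdSimplex ℝ R) (hd : ∀ r, 0 ≤ d r) {α D : ℝ} (hα₀ : 0 < α) (hα₁ : α ≤ 1)
    (hD : 0 ≤ D) (h : ∑ r, μ r * d r ^ 2 ≤ D ^ 2) : ∑ r, μ r * d r ^ α ≤ D ^ α := by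
  have h1 := Real.arith_mean_le_rpow_mean Finset.univ μ (fun r => d r ^ α) (fun r _ => hμ.1 r)
    hμ.2 (fun r _ => Real.rpow_nonneg (hd r) α) (p := 2 / α)
    (by rw [le_div_iff₀ hα₀]; linarith)
  have h2 : ∀ x : ℝ, 0 ≤ x → (x ^ α) ^ (2 / α) = x ^ 2 := fun x hx => by
    rw [← Real.rpow_mul hx, mul_div_cancel₀ _ hα₀.ne', Real.rpow_two]
  simp only [h2 _ (hd _)] at h1
  refine h1.trans ?_
  have h3 : D ^ α = (D ^ 2) ^ (1 / (2 / α)) := by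
    rw [← h2 D hD, ← Real.rpow_mul (Real.rpow_nonneg hD α), mul_one_div_cancel (by positivity),
      Real.rpow_one]
  rw [h3]
  exact Real.rpow_le_rpow (Finset.sum_nonneg fun r _ => mul_nonneg (hμ.1 r) (sq_nonneg _)) h
    (by positivity)

end RandomRetraction

/-! ### Averaging `f` over the random retraction. -/

theorem corollary1p3
    {𝕜 : Type*} [RCLike 𝕜]
    {H : Type*} [NormedAddCommGroup H] [InnerProductSpace 𝕜 H] [CompleteSpace H]
    {E : Type*} [NormedAddCommGroup E] [NormedSpace ℝ E] [CompleteSpace E]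
    (α L : ℝ≥0) (hα₀ : 0 < α) (hα₁ : α ≤ 1)
    (X S : Set H) (hX : X.Finite) (hSX : S ⊆ X) (hS : S.Nonempty)
    (f : S → E) (hf : HolderWith L α f) :
    ∃ (g : X → convexHull ℝ (Set.range f)) (L' : ℝ≥0),
      (∀ s : S, (g (Set.inclusion hSX s) : E) = f s) ∧
      HolderWith L' α g ∧
      (L' : ℝ) ≤ Real.sqrt ((X \ S).ncard + 1) ^ (α : ℝ) * L := by
  classical
  -- Only norms of differences matter, so the real part of the inner product suffices.
  let _ : InnerProductSpace ℝ H := InnerProductSpace.rclikeToReal 𝕜 H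
  let _ : Fintype X := hX.fintype
  set T : Finset X := Finset.univ.filter fun x => (x : H) ∈ S with hT
  have hmem : ∀ x, x ∈ T ↔ (x : H) ∈ S := fun x => by simp [hT]
  have hTne : T.Nonempty := by
    obtain ⟨s, hs⟩ := hS
    exact ⟨⟨s, hSX hs⟩, (hmem _).2 hs⟩
  have hcard : (Tᶜ).card = (X \ S).ncard := by
    have himg : ((Tᶜ.map (Function.Embedding.subtype _) : Finset H) : Set H) = X \ S := by
      ext x
      simp only [Finset.coe_map, Set.mem_image, Finset.mem_coe, Finset.mem_compl, hmem]
      exact ⟨by rintro ⟨z, hz, rfl⟩; exact ⟨z.2, hz⟩, fun hx => ⟨⟨x, hx.1⟩, hx.2, rfl⟩⟩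
    rw [← himg, Set.ncard_coe_finset, Finset.card_map]
  obtain ⟨μ, hμ, hle⟩ := exists_forest_distribution hTne (fun x : X => (x : H))
  rw [hcard] at hle
  have hroot : ∀ (φ : rootedForests T) (x : X), ((forestRoot T φ x : X) : H) ∈ S := fun φ x =>
    (hmem _).1 ((mem_rootedForests.1 φ.2).root_mem x)
  let F : rootedForests T → X → E := fun φ x => f ⟨(forestRoot T φ x : X), hroot φ x⟩
  let g : X → convexHull ℝ (Set.range f) := fun x => ⟨∑ φ, μ φ • F φ x,
    (convex_convexHull ℝ _).sum_mem (fun φ _ => hμ.1 φ) hμ.2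
      fun φ _ => subset_convexHull ℝ _ ⟨_, rfl⟩⟩
  have hK : (0 : ℝ) ≤ (X \ S).ncard + 1 := by positivity
  have hα : (0 : ℝ) < α := hα₀
  refine ⟨g, NNReal.sqrt ((X \ S).ncard + 1) ^ (α : ℝ) * L, fun s => ?_, ?_,
    by simp⟩
  · have hs : Set.inclusion hSX s ∈ T := (hmem _).2 s.2
    have hF : ∀ φ, F φ (Set.inclusion hSX s) = f s := fun φ => by
      simp only [F, (mem_rootedForests.1 φ.2).root_of_mem hs, Set.coe_inclusion]
    simp only [g, hF, ← Finset.sum_smul, hμ.2, one_smul]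
  · have hdist : ∀ x y : X, dist (g x) (g y) ≤
        Real.sqrt ((X \ S).ncard + 1) ^ (α : ℝ) * L * dist x y ^ (α : ℝ) := by
      intro x y
      calc dist (g x) (g y) = ‖∑ φ, μ φ • (F φ x - F φ y)‖ := by
            simp only [Subtype.dist_eq, g, dist_eq_norm, smul_sub, Finset.sum_sub_distrib]
        _ ≤ ∑ φ, μ φ * (L *
              ‖((forestRoot T φ x : X) : H) - ((forestRoot T φ y : X) : H)‖ ^ (α : ℝ)) := by
            refine (norm_sum_le _ _).trans (Finset.sum_le_sum fun φ _ => ?_)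
            rw [norm_smul, Real.norm_of_nonneg (hμ.1 φ), ← dist_eq_norm, ← dist_eq_norm]
            exact mul_le_mul_of_nonneg_left (hf.dist_le _ _) (hμ.1 φ)
        _ = L * ∑ φ, μ φ *
              ‖((forestRoot T φ x : X) : H) - ((forestRoot T φ y : X) : H)‖ ^ (α : ℝ) := by
            rw [Finset.mul_sum]
            exact Finset.sum_congr rfl fun φ _ => mul_left_comm _ _ _
        _ ≤ L * (Real.sqrt ((X \ S).ncard + 1) * ‖(x : H) - y‖) ^ (α : ℝ) := by
            refine mul_le_mul_of_nonneg_left ?_ L.2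
            refine sum_mul_rpow_le_of_sum_mul_sq_le hμ (fun _ => norm_nonneg _) hα hα₁
              (by positivity) ?_
            rw [mul_pow, Real.sq_sqrt hK]
            exact hle x y
        _ = _ := by
            rw [Real.mul_rpow (Real.sqrt_nonneg _) (norm_nonneg _), Subtype.dist_eq,
              dist_eq_norm]
            ring
    intro x y
    rw [edist_nndist, edist_nndist, ← ENNReal.coe_rpow_of_nonneg _ hα.le, ← ENNReal.coe_mul,
      ENNReal.coe_le_coe, ← NNReal.coe_le_coe]
    simpa using hdist x y
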